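/- **The main game.** There are five players, $\text{Alice}_1,\text{Alice}_2,\text{Alice}_3$, Bob and Charlie. $\text{Alice}_i$ receives a bit $x_i$ and outputs a bit $a_i$; Bob and Charlie both receive the same bit $z$ and output three bits each, $b_1,b_2,b_3$ and $c_1,c_2,c_3$. Write $\oplus,\wedge,\neg$ for XOR, AND, NOT. * If $z=0$, it is promised that $x_1\oplus x_2\oplus x_3=0$, and the answers are accepted if and only if $$a_1\oplus a_2\oplus a_3\oplus\bigl[(c_1\wedge\neg x_1)\oplus(c_2\wedge\neg x_2)\oplus(c_3\wedge\neg x_3)\bigr]=\beta,$$ where $\beta=b_1\oplus b_2\oplus b_3\oplus 1,\; b_1,\; b_2,\; b_3$ for $(x_1,x_2,x_3)=(0,0,0),(0,1,1),(1,0,1),(1,1,0)$ respectively. (Each Alice labels one node of a non-horizontal hyperedge of the magic pentagram, whose parity is set by Charlie's output; Bob labels the three leftmost nodes of the horizontal hyperedge, which has odd parity; the two labels of the common node must agree.) * If $z=1$, it is promised that $x_1=x_2=x_3=1$, and the answers are accepted if and only if $a_i=b_i=c_i$ for $i=1,2,3$. A strategy *wins* the game if for every input allowed by the promise the answers are accepted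 with probability $1$. **Theorem.** The main game cannot be won using arbitrary bipartite nonsignalling resources and shared randomness $\lambda$ (drawn from an arbitrary probability space) common to all five players. This holds for both usual meanings of such resources: 1. *Nonsignalling correlations.* Finitely many independent boxes, any number for each pair of players, each of them shared by two different players. A box is a family of discrete probability distributions $P(o,o'\mid u,u')$ on pairs of outputs, for arbitrary nonempty sets of inputs and arbitrary sets of outputs, such that the marginal distribution of $o$ does not depend on $u'$ and that of $o'$ does not depend on $u$. Each player knows $\lambda$ and her own input, uses each of her ends of the boxes at most once, in an order and with inputs that may depend adaptively on the outputs she has already obtained, and then answers. 2. *Bipartite states of an arbitrary nonsignalling theory, jointly measured.* Finitely many bipartite resources, each shared by two different players, described in a generalised probabilistic theory with finite-dimensional real state spaces, whose composites are tensor products. Each resource is a bipartite state on which the product of the two discarding functionals takes the value $1$. Each player, depending on $\lambda$ and her own input, performs one joint measurement on all her systems, given by functionals (one for each answer) that add up to the product of the discarding functionals of these systems. The probability of a joint answer is the contraction of all states with all effects. Devices can be replicated: whenever finitely many copies of the players and of the resources are connected, each copy of a resource end going to a copy of the player who holds that kind of end, with arbitrary inputs and values of $\lambda$ for each copy of a player,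 the contraction is nonnegative. -/

import Mathlib

open MeasureTheory
open scoped ENNReal

universe u v

/-! ## Nonlocal games and the main game -/

/-- A nonlocal game with set of players `P`: every player has a finite input set and a finite
output set, `promise` says which joint inputs can occur, and `rule x a` says that the joint
output `a` is accepted on the joint input `x`. -/
structure NonlocalGame (P : Type) where
  In : P → Type
  Out : P → Type
  [finiteIn : ∀ p, Finite (In p)]
  [fintypeOut : ∀ p, Fintype (Out p)]
  promise : (∀ p, In p) → Prop
  rule : (∀ p, In p) → (∀ p, Out p) → Prop

attribute [instance] NonlocalGame.finiteIn NonlocalGame.fintypeOut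

/-- The five players. -/
inductive Player : Type
  | alice (i : Fin 3)
  | bob
  | charlie
  deriving DecidableEq, Fintype

/-- Every Alice outputs one bit, Bob and Charlie output three bits each. -/
abbrev Player.Out : Player → Type
  | .alice _ => Bool
  | .bob => Fin 3 → Bool
  | .charlie => Fin 3 → Bool

instance (p : Player) : Fintype p.Out :=
  match p with
  | .alice _ => inferInstanceAs (Fintype Bool)
  | .bob => inferInstanceAs (Fintype (Fin 3 → Bool))
  | .charlie => inferInstanceAs (Fintype (Fin 3 → Bool))

/-- Bob labels the three leftmost nodes of the horizontal hyperedge of the pentagram with the bits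
`b 0, b 1, b 2`; the label of the fourth node follows, because this hyperedge has odd parity.
`bobLabel x b` is Bob's label of the node in which the horizontal hyperedge meets the hyperedge
given by the Alices' inputs `x`. (On the triples that are not a hyperedge the value is
irrelevant, as they are excluded by the promise.) -/
def bobLabel (x : Fin 3 → Bool) (b : Fin 3 → Bool) : Bool :=
  match x 0, x 1, x 2 with
  | false, false, false => !(b 0 ^^ b 1 ^^ b 2)
  | false, true, true => b 0
  | true, false, true => b 1
  | true, true, false => b 2
  | _, _, _ => false

/-- The parity that Charlie's output `c` prescribes for the hyperedge given by `x`
(`true` means odd). -/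
def requiredParity (x : Fin 3 → Bool) (c : Fin 3 → Bool) : Bool :=
  (c 0 && !x 0) ^^ (c 1 && !x 1) ^^ (c 2 && !x 2)

/-- The label that the Alices' answers give to the fourth node of their hyperedge, so that the
hyperedge has the required parity. -/
def aliceLabel (x : Fin 3 → Bool) (a : Fin 3 → Bool) (c : Fin 3 → Bool) : Bool :=
  a 0 ^^ a 1 ^^ a 2 ^^ requiredParity x c

/-- The main game. All inputs are bits (`false` is 0 and `true` is 1), and Bob and Charlie get the
same bit `z`. If `z = 0`, the Alices' inputs have even parity, and the Alices and Bob must agree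
on the node in which their hyperedges meet. If `z = 1`, the Alices' inputs are all 1, and the
players play three equality games in parallel. -/
def mainGame : NonlocalGame Player where
  In _ := Bool
  Out := Player.Out
  promise x :=
    x .bob = x .charlie ∧
    (x .bob = false → (x (.alice 0) ^^ x (.alice 1) ^^ x (.alice 2)) = false) ∧
    (x .bob = true → ∀ i, x (.alice i) = true)
  rule x a :=
    (x .bob = false →
      aliceLabel (fun i => x (.alice i)) (fun i => a (.alice i)) (a .charlie) =
        bobLabel (fun i => x (.alice i)) (a .bob)) ∧
    (x .bob = true → ∀ i, a (.alice i) = a .bob i ∧ a .bob i = a .charlie i)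

open Classical in
/-- The probability that a joint input `x` is won, when the shared randomness `ω` is drawn from `μ`
and `f ω x a` is the probability of the joint output `a` given `x` and `ω`. -/
noncomputable def NonlocalGame.winProb {P : Type} [Fintype P] (G : NonlocalGame P)
    {Ω : Type u} [MeasurableSpace Ω] (μ : Measure Ω)
    (f : Ω → (∀ p, G.In p) → (∀ p, G.Out p) → ℝ≥0∞) (x : ∀ p, G.In p) : ℝ≥0∞ :=
  ∫⁻ ω, ∑ a : ∀ p, G.Out p, (if G.rule x a then f ω x a else 0) ∂μ

/-- The game is won: every joint input allowed by the promise is won with probability one. -/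
def NonlocalGame.Won {P : Type} [Fintype P] (G : NonlocalGame P)
    {Ω : Type u} [MeasurableSpace Ω] (μ : Measure Ω)
    (f : Ω → (∀ p, G.In p) → (∀ p, G.Out p) → ℝ≥0∞) : Prop :=
  ∀ x, G.promise x → G.winProb μ f x = 1

/-! ## Bipartite resources -/

/-- A finite collection of bipartite resources. Resource `k` has two ends, `0` and `1`, which are
held by two different players. A pair of players may share any number of resources. -/
structure BipartiteNetwork (P : Type) where
  Res : Type
  [fintypeRes : Fintype Res]
  holder : Res → Fin 2 → P
  holder_ne : ∀ k, holder k 0 ≠ holder k 1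

attribute [instance] BipartiteNetwork.fintypeRes

/-- The ends of the resources. -/
abbrev BipartiteNetwork.End {P : Type} (N : BipartiteNetwork P) : Type := N.Res × Fin 2

/-- The ends that are held by player `p`. -/
def BipartiteNetwork.ends {P : Type} (N : BipartiteNetwork P) (p : P) : Set N.End :=
  {q | N.holder q.1 q.2 = p}

/-! ## Nonsignalling boxes and their wirings -/

/-- A bipartite nonsignalling correlation: for every pair of inputs a probability distribution on
pairs of outputs, such that the distribution of the output at one end does not depend on the
input at the other end. -/
structure NonsignallingBox where
  In : Fin 2 → Type v
  Out : Fin 2 → Type v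
  [nonemptyIn : ∀ e, Nonempty (In e)]
  corr : (∀ e, In e) → PMF (∀ e, Out e)
  nonsignalling : ∀ (e : Fin 2) (u u' : ∀ e, In e), u e = u' e →
    (corr u).map (fun o => o e) = (corr u').map (fun o => o e)

attribute [instance] NonsignallingBox.nonemptyIn

/-- An adaptive procedure of one player: it either stops with an answer, or puts an input into one
end of a box and goes on in a way that depends on the output. -/
inductive Protocol {ι : Type} (I O : ι → Type v) (A : Type) : Type v
  | answer (a : A) : Protocol I O A
  | query (q : ι) (u : I q) (next : O q → Protocol I O A) : Protocol I O A

namespace Protocol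

variable {ι : Type} {I O : ι → Type v} {A : Type}

/-- The procedure uses only ends from `S`, and each of them at most once. -/
def UsesOnly : Protocol I O A → Set ι → Prop
  | answer _, _ => True
  | query q _ next, S => q ∈ S ∧ ∀ o, (next o).UsesOnly (S \ {q})

/-- The final answer, if the outputs at the ends are `o`. -/
def result (o : ∀ q, O q) : Protocol I O A → A
  | answer a => a
  | query q _ next => (next (o q)).result o

open Classical in
/-- The inputs that the procedure puts into the ends, if the outputs at the ends are `o`; an end
that it does not use gets the input `idle`. -/
noncomputable def inputs (idle : ∀ q, I q) (o : ∀ q, O q) : Protocol I O A → ∀ q, I q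
  | answer _ => idle
  | query q u next => Function.update ((next (o q)).inputs idle o) q u

end Protocol

/-- A strategy that uses shared randomness `Ω` common to all players and bipartite nonsignalling
boxes. Given the shared randomness and her own input, each player follows an adaptive procedure on
her ends of the boxes. -/
structure BoxStrategy {P : Type} (G : NonlocalGame P) where
  Ω : Type u
  [measurableSpace : MeasurableSpace Ω]
  μ : Measure Ω
  [isProbabilityMeasure : IsProbabilityMeasure μ]
  net : BipartiteNetwork P
  box : net.Res → NonsignallingBox.{v}
  protocol : ∀ p, Ω → G.In p →
    Protocol (fun q : net.End => (box q.1).In q.2) (fun q : net.End => (box q.1).Out q.2) (G.Out p)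
  usesOnly : ∀ p ω x, (protocol p ω x).UsesOnly (net.ends p)

attribute [instance] BoxStrategy.measurableSpace BoxStrategy.isProbabilityMeasure

namespace BoxStrategy

variable {P : Type} {G : NonlocalGame P}

/-- The input at the end `q`, if the outputs at the ends are `o`. -/
noncomputable def inputAt (S : BoxStrategy.{u, v} G) (ω : S.Ω) (x : ∀ p, G.In p)
    (o : ∀ q : S.net.End, (S.box q.1).Out q.2) (q : S.net.End) : (S.box q.1).In q.2 :=
  (S.protocol (S.net.holder q.1 q.2) ω (x (S.net.holder q.1 q.2))).inputs
    (fun _ => Classical.arbitrary _) o q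

/-- The probability that the boxes, which are independent of each other, give the outputs `o`. -/
noncomputable def weight (S : BoxStrategy.{u, v} G) (ω : S.Ω) (x : ∀ p, G.In p)
    (o : ∀ q : S.net.End, (S.box q.1).Out q.2) : ℝ≥0∞ :=
  ∏ k : S.net.Res, (S.box k).corr (fun e => S.inputAt ω x o (k, e)) (fun e => o (k, e))

open Classical in
/-- The probability of the joint output `a`, given the joint input `x` and the shared
randomness `ω`. -/
noncomputable def behaviour (S : BoxStrategy.{u, v} G) (ω : S.Ω) (x : ∀ p, G.In p)
    (a : ∀ p, G.Out p) : ℝ≥0∞ :=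
  ∑' o : ∀ q : S.net.End, (S.box q.1).Out q.2,
    if (∀ p, (S.protocol p ω (x p)).result o = a p) then S.weight ω x o else 0

/-- The strategy wins the game. -/
def Wins [Fintype P] (S : BoxStrategy.{u, v} G) : Prop := G.Won S.μ S.behaviour

end BoxStrategy

/-! ## Bipartite states of arbitrary nonsignalling physical theories, jointly measured -/

/-- States and measurements of a generalised probabilistic theory, in coordinates. The end `e` of
resource `k` is a system whose state space has a basis indexed by `Sys k e`; `state k` is the
tensor of a bipartite state, `discard k e` is the functional that discards the system, and
`effect p ω x a` is the functional, on the tensor product of all systems that player `p` holds,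
that belongs to the output `a` of her measurement given her input `x` and the shared
randomness `ω`. -/
structure Devices {P : Type} (G : NonlocalGame P) (Ω : Type u) where
  net : BipartiteNetwork P
  Sys : net.Res → Fin 2 → Type
  [fintypeSys : ∀ k e, Fintype (Sys k e)]
  state : ∀ k, (∀ e, Sys k e) → ℝ
  discard : ∀ k e, Sys k e → ℝ
  effect : ∀ p, Ω → G.In p → G.Out p → (∀ q : net.ends p, Sys q.1.1 q.1.2) → ℝ

attribute [instance] Devices.fintypeSys

namespace Devices

variable {P : Type} [Fintype P] {G : NonlocalGame P} {Ω : Type u}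

open Classical in
/-- Take `n` copies of every player and of every resource, and give end `e` of copy `m` of
resource `k` to copy `link k e m` of the player who holds this kind of end. `circuit` is the number
that the theory assigns to the event that copy `m` of player `p`, on input `x m p` and with
`ω m p` in place of the shared randomness, outputs `a m p`, for all `m` and `p`: the contraction of
all states with all effects. -/
noncomputable def circuit (T : Devices G Ω) {n : ℕ}
    (link : T.net.Res → Fin 2 → Equiv.Perm (Fin n))
    (ω : Fin n → P → Ω) (x : Fin n → ∀ p, G.In p) (a : Fin n → ∀ p, G.Out p) : ℝ :=
  ∑ s : Fin n → ∀ q : T.net.End, T.Sys q.1 q.2,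
    (∏ m, ∏ k, T.state k (fun e => s (link k e m) (k, e))) *
      ∏ m, ∏ p, T.effect p (ω m p) (x m p) (a m p) (fun q => s m q.1)

open Classical in
/-- The devices belong to a theory in which nothing signals and in which devices can be replicated:
states are normalised, the effects of every measurement add up to discarding all its systems (so
that the choice of a measurement cannot be noticed elsewhere), and in every arrangement of
independent copies of the players and resources the probabilities are nonnegative. -/
structure IsNonsignalling (T : Devices G Ω) : Prop where
  state_norm : ∀ k, ∑ s : ∀ e, T.Sys k e, T.state k s * ∏ e, T.discard k e (s e) = 1
  effect_sum : ∀ p ω x (s : ∀ q : T.net.ends p, T.Sys q.1.1 q.1.2),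
    ∑ a, T.effect p ω x a s = ∏ q : T.net.ends p, T.discard q.1.1 q.1.2 (s q)
  circuit_nonneg : ∀ (n : ℕ) (link : T.net.Res → Fin 2 → Equiv.Perm (Fin n)) ω x a,
    0 ≤ T.circuit link ω x a

end Devices

/-- A strategy that uses shared randomness `Ω` common to all players and bipartite states of an
arbitrary nonsignalling theory. Each player performs a joint measurement on all her systems. -/
structure TheoryStrategy {P : Type} [Fintype P] (G : NonlocalGame P) where
  Ω : Type u
  [measurableSpace : MeasurableSpace Ω]
  μ : Measure Ω
  [isProbabilityMeasure : IsProbabilityMeasure μ]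
  devices : Devices G Ω
  nonsignalling : devices.IsNonsignalling

attribute [instance] TheoryStrategy.measurableSpace TheoryStrategy.isProbabilityMeasure

namespace TheoryStrategy

variable {P : Type} [Fintype P] {G : NonlocalGame P}

/-- The probability of the joint output `a`, given the joint input `x` and the shared
randomness `ω`: one copy of everything, connected in the only possible way. -/
noncomputable def behaviour (S : TheoryStrategy.{u} G) (ω : S.Ω) (x : ∀ p, G.In p)
    (a : ∀ p, G.Out p) : ℝ≥0∞ :=
  ENNReal.ofReal (S.devices.circuit (n := 1) (fun _ _ => 1) (fun _ _ => ω) (fun _ => x)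
    (fun _ => a))

/-- The strategy wins the game. -/
def Wins (S : TheoryStrategy.{u} G) : Prop := G.Won S.μ S.behaviour

end TheoryStrategy

/-! Only possibilities matter. For almost every value of λ all promised inputs are won with
certainty, so λ can be fixed (`NonlocalGame.Won.exists_forall_rule`), and it remains to study which
joint outputs have nonzero probability.

For z = 1, let A be one of the Alices, B Bob and C Charlie. Take two copies of everything and
connect the resources between A and C crosswise. Then A₀–B₀–C₀–A₁ is a chain: neighbours share what
they share in the original network, so they must answer equally, while A₀ and A₁ share nothing, so
any two possible outputs of A can occur together at A₀ and A₁. Hence the output of Alice_i on input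
1 is a constant t_i.

For z = 0, fix a possible outcome s, b, c on input 000. If the inputs of two Alices are switched to
1, the third Alice, Bob and Charlie can still give these answers, and the two switched Alices are
forced to answer with their t's. So the four winning conditions hold for one and the same set of
bits s, t, b, c. In the XOR of the four conditions every bit occurs twice and a constant 1 is left,
a contradiction (`BipartitePossibility.mainGame_false`).

Both kinds of resources satisfy `BipartitePossibility` because partial outcomes extend. For boxes
this is `exists_wiring_extension`, which rests on the factorisation `tsum_wiring_weight`. For
theories it is `Devices.IsNonsignalling.exists_circuit_ne_zero`, which rests on
`Devices.marginal_relabel` and the nonnegativity of rewired circuits. -/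

/-! ### Fixing the shared randomness. -/

theorem NonlocalGame.Won.exists_forall_rule {P : Type} [Fintype P] {G : NonlocalGame P}
    {Ω : Type u} [MeasurableSpace Ω] {μ : Measure Ω} [IsProbabilityMeasure μ]
    {f : Ω → (∀ p, G.In p) → (∀ p, G.Out p) → ℝ≥0∞} (hf : ∀ ω x, ∑' a, f ω x a ≤ 1)
    (h : G.Won μ f) :
    ∃ ω, ∀ x, G.promise x → (∃ a, f ω x a ≠ 0) ∧ ∀ a, f ω x a ≠ 0 → G.rule x a := by
  classical
  simp only [tsum_fintype] at hf
  set g : (∀ p, G.In p) → Ω → ℝ≥0∞ := fun x ω =>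
    ∑ a : ∀ p, G.Out p, (if G.rule x a then f ω x a else 0) with hg
  have hle : ∀ x ω, g x ω ≤ ∑ a, f ω x a := fun x ω =>
    Finset.sum_le_sum fun a _ => by split_ifs <;> simp
  have hae : ∀ x, G.promise x → ∀ᵐ ω ∂μ, 1 ≤ g x ω := by
    intro x hx
    -- `f` need not be measurable in `ω`, so `g x` is replaced by a measurable minorant with the
    -- same integral.
    obtain ⟨φ, hφm, hφle, hφ⟩ := exists_measurable_le_lintegral_eq μ (g x)
    have h1 : ∫⁻ ω, φ ω ∂μ = 1 := by
      rw [← hφ, ← h x hx]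
      unfold NonlocalGame.winProb
      rfl
    have hφ1 : ∀ ω, φ ω ≤ 1 := fun ω => (hφle ω).trans ((hle x ω).trans (hf ω x))
    have h2 : φ =ᵐ[μ] fun _ => 1 :=
      ae_eq_of_ae_le_of_lintegral_le (Filter.Eventually.of_forall hφ1) (by simp [h1])
        aemeasurable_const (by simp [h1])
    filter_upwards [h2] with ω hω
    rw [← hω]
    exact hφle ω
  have hall : ∀ᵐ ω ∂μ, ∀ x, G.promise x → 1 ≤ g x ω := by
    rw [ae_all_iff]
    intro x
    by_cases hx : G.promise x
    · filter_upwards [hae x hx] with ω hω _ using hω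
    · exact Filter.Eventually.of_forall fun ω h => absurd h hx
  obtain ⟨ω, hω⟩ := hall.exists
  refine ⟨ω, fun x hx => ⟨?_, fun a ha => ?_⟩⟩
  · by_contra! hcon
    have := (hω x hx).trans (hle x ω)
    simp [hcon] at this
  · by_contra hr
    -- The accepted outputs already exhaust the total mass 1, so a rejected output has no mass left.
    have h1 : g x ω + f ω x a ≤ ∑ a, f ω x a := by
      calc g x ω + f ω x a
          = ∑ b, ((if G.rule x b then f ω x b else 0) + if b = a then f ω x b else 0) := by
            rw [Finset.sum_add_distrib]; simp [hg]
        _ ≤ ∑ a, f ω x a := Finset.sum_le_sum fun b _ => by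
            by_cases hb : b = a
            · subst hb; simp [hr]
            · simp only [hb, if_false, add_zero]; split_ifs <;> simp
    have h2 : 1 + f ω x a ≤ 1 + 0 :=
      (add_le_add_left (hω x hx) _).trans ((h1.trans (hf ω x)).trans (by simp))
    exact ha (le_antisymm ((ENNReal.add_le_add_iff_left ENNReal.one_ne_top).1 h2) bot_le)

/-! ### The possibilistic core: the game contradicts no-signalling plus inflation. -/

/-- Which joint outputs are possible given the joint input, in a network of bipartite resources:
what a set of players can output does not depend on the inputs of the others, and there is a
network of two copies of everything in which the first copies of `A` and `B`, the first copies of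
`B` and `C`, and the second copy of `A` and the first copy of `C`, share what they share in the
original network, while the two copies of `A` share nothing. -/
structure BipartitePossibility {P : Type} (G : NonlocalGame P)
    (R : (∀ p, G.In p) → (∀ p, G.Out p) → Prop) : Prop where
  nosig : ∀ (T : Set P) (x x' : ∀ p, G.In p), (∀ p ∈ T, x p = x' p) → ∀ a, R x a →
    ∃ a', R x' a' ∧ ∀ p ∈ T, a' p = a p
  inflation : ∀ (x : ∀ p, G.In p) (A B C : P), A ≠ B → A ≠ C → B ≠ C →
    ∃ Q : (Fin 2 → ∀ p, G.Out p) → Prop,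
      (∀ a b, R x a → R x b → ∃ q, Q q ∧ q 0 A = a A ∧ q 1 A = b A) ∧
      ∀ q, Q q → (∃ a, R x a ∧ a A = q 0 A ∧ a B = q 0 B) ∧
        (∃ a, R x a ∧ a B = q 0 B ∧ a C = q 0 C) ∧ (∃ a, R x a ∧ a A = q 1 A ∧ a C = q 0 C)

theorem BipartitePossibility.mainGame_false
    {R : (∀ p, mainGame.In p) → (∀ p, mainGame.Out p) → Prop}
    (hR : BipartitePossibility mainGame R)
    (hwin : ∀ x, mainGame.promise x → (∃ a, R x a) ∧ ∀ a, R x a → mainGame.rule x a) : False := by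
  have hp1 : mainGame.promise (fun _ => true) := by simp [mainGame]
  have hdet : ∀ i a b, R (fun _ => true) a → R (fun _ => true) b →
      a (.alice i) = b (.alice i) := by
    intro i a b ha hb
    obtain ⟨Q, hQ, hQ'⟩ := hR.inflation (fun _ => true) (.alice i) .bob .charlie
      (by simp) (by simp) (by simp)
    obtain ⟨q, hq, hqa, hqb⟩ := hQ a b ha hb
    -- `d`, `e`, `f` realise the links A₀B₀, B₀C₀, A₁C₀ of the chain as outcomes of the original
    -- network.
    obtain ⟨⟨d, hd, hd1, hd2⟩, ⟨e, he, he1, he2⟩, ⟨f, hf, hf1, hf2⟩⟩ := hQ' q hq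
    have h1 := ((hwin _ hp1).2 d hd).2 rfl i
    have h2 := ((hwin _ hp1).2 e he).2 rfl i
    have h3 := ((hwin _ hp1).2 f hf).2 rfl i
    rw [← hqa, ← hqb, ← hd1, ← hf1]
    rw [h1.1, h3.1, h3.2, hd2, hf2, ← he1, ← he2, h2.2]
  have hp0 : mainGame.promise (fun _ => false) := by simp [mainGame]
  obtain ⟨a, ha⟩ := (hwin _ hp0).1
  obtain ⟨b, hb, -⟩ := hR.nosig ∅ (fun _ => false) (fun _ => true) (by simp) a ha
  have key : ∀ i : Fin 3, ∃ a', R (fun p => match p with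
        | .alice j => decide (j ≠ i) | .bob => false | .charlie => false) a' ∧
      a' (.alice i) = a (.alice i) ∧ a' .bob = a .bob ∧ a' .charlie = a .charlie ∧
      ∀ j, j ≠ i → a' (.alice j) = b (.alice j) := by
    intro i
    obtain ⟨a', ha', hT⟩ := hR.nosig {.alice i, .bob, .charlie} (fun _ => false) (fun p => match p with
        | .alice j => decide (j ≠ i) | .bob => false | .charlie => false)
      (by simp only [Set.forall_mem_insert, Set.mem_singleton_iff, forall_eq]
          exact ⟨(decide_eq_false (by simp)).symm, rfl, rfl⟩) a ha
    refine ⟨a', ha', hT _ (by simp), hT _ (by simp), hT _ (by simp), fun j hj => ?_⟩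
    -- Seen by Alice j alone, the input might as well be all ones, where `hdet` fixes her output.
    obtain ⟨c, hc, hT'⟩ := hR.nosig {.alice j} _ (fun _ => true) (by rintro _ rfl; exact decide_eq_true hj) a' ha'
    rw [← hT' _ rfl]
    exact hdet j c b hc hb
  have h0 := ((hwin _ hp0).2 a ha).1 rfl
  obtain ⟨a0, ha0, ha00, hB0, hC0, hj0⟩ := key 0
  obtain ⟨a1, ha1, ha11, hB1, hC1, hj1⟩ := key 1
  obtain ⟨a2, ha2, ha22, hB2, hC2, hj2⟩ := key 2
  have e0 := ((hwin _ (by simp [mainGame])).2 a0 ha0).1 rfl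
  have e1 := ((hwin _ (by simp [mainGame])).2 a1 ha1).1 rfl
  have e2 := ((hwin _ (by simp [mainGame])).2 a2 ha2).1 rfl
  rw [hB0, hC0] at e0
  rw [hB1, hC1] at e1
  rw [hB2, hC2] at e2
  simp only [aliceLabel, bobLabel, requiredParity] at h0 e0 e1 e2
  rw [ha00, hj0 1 (by decide), hj0 2 (by decide)] at e0
  rw [ha11, hj1 0 (by decide), hj1 2 (by decide)] at e1
  rw [ha22, hj2 0 (by decide), hj2 1 (by decide)] at e2
  simp at h0 e0 e1 e2
  generalize a (.alice 0) = s0, a (.alice 1) = s1, a (.alice 2) = s2, b (.alice 0) = t0,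
    b (.alice 1) = t1, b (.alice 2) = t2, a .bob = v, a .charlie = w at h0 e0 e1 e2
  change Bool at s0 s1 s2 t0 t1 t2
  change Fin 3 → Bool at v w
  -- Eliminating Bob's bits leaves an equation between an XOR and its own negation: each `t`
  -- cancels.
  rw [← e0, ← e1, ← e2] at h0
  clear e0 e1 e2
  generalize w 0 = w0, w 1 = w1, w 2 = w2 at h0
  revert h0
  revert s0 s1 s2 t0 t1 t2 w0 w1 w2
  decide

/-! ### Adaptive procedures. -/

namespace Protocol

section
variable {ι : Type} {I O : ι → Type v} {A : Type}

theorem inputs_query_self (idle : ∀ q, I q) (o : ∀ q, O q) (q : ι) (u : I q)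
    (next : O q → Protocol I O A) : (query q u next).inputs idle o q = u := by
  simp [inputs]

theorem inputs_query_of_ne (idle : ∀ q, I q) (o : ∀ q, O q) {q r : ι} (h : r ≠ q) (u : I q)
    (next : O q → Protocol I O A) :
    (query q u next).inputs idle o r = (next (o q)).inputs idle o r := by
  simp [inputs, h]

theorem UsesOnly.mono {π : Protocol I O A} : ∀ {S S' : Set ι}, π.UsesOnly S → S ⊆ S' →
    π.UsesOnly S' := by
  induction π with
  | answer a => intros; trivial
  | query q u next ih =>
    intro S S' h hS
    exact ⟨hS h.1, fun o => ih o (h.2 o) (Set.sdiff_subset_sdiff_left hS)⟩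

theorem inputs_of_notMem {π : Protocol I O A} (idle : ∀ q, I q) (o : ∀ q, O q) :
    ∀ {S : Set ι}, π.UsesOnly S → ∀ {q}, q ∉ S → π.inputs idle o q = idle q := by
  induction π with
  | answer a => intros; rfl
  | query r u next ih =>
    intro S h q hq
    rw [inputs_query_of_ne _ _ (by rintro rfl; exact hq h.1)]
    exact ih _ (h.2 _) (fun h' => hq h'.1)

theorem inputs_congr_idle (π : Protocol I O A) {idle idle' : ∀ q, I q} (o : ∀ q, O q) {q : ι}
    (h : idle q = idle' q) : π.inputs idle o q = π.inputs idle' o q := by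
  induction π with
  | answer a => exact h
  | query r u next ih =>
    by_cases hr : q = r
    · subst hr; simp only [inputs_query_self]
    · simp only [inputs_query_of_ne _ _ hr, ih]

theorem inputs_congr {π : Protocol I O A} (idle : ∀ q, I q) {o o' : ∀ q, O q} :
    ∀ {S : Set ι}, π.UsesOnly S → (∀ q ∈ S, o q = o' q) →
      π.inputs idle o = π.inputs idle o' := by
  induction π with
  | answer a => intros; rfl
  | query r u next ih =>
    intro S h ho
    simp only [inputs]
    rw [ho r h.1, ih _ (h.2 _) fun q hq => ho q hq.1]

theorem result_congr {π : Protocol I O A} {o o' : ∀ q, O q} :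
    ∀ {S : Set ι}, π.UsesOnly S → (∀ q ∈ S, o q = o' q) → π.result o = π.result o' := by
  induction π with
  | answer a => intros; rfl
  | query r u next ih =>
    intro S h ho
    simp only [result]
    rw [ho r h.1, ih _ (h.2 _) fun q hq => ho q hq.1]

end

section
variable {ι κ : Type} {I O : κ → Type v} {A : Type}

/-- The same procedure, where the end `q` is now called `f q`. -/
def map (f : ι → κ) : Protocol (fun q => I (f q)) (fun q => O (f q)) A → Protocol I O A
  | answer a => answer a
  | query q u next => query (f q) u fun o => (next o).map f

variable {f : ι → κ}

theorem UsesOnly.map (hf : f.Injective) {π : Protocol (fun q => I (f q)) (fun q => O (f q)) A} :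
    ∀ {S : Set ι}, π.UsesOnly S → (π.map f).UsesOnly (f '' S) := by
  induction π with
  | answer a => intros; trivial
  | query q u next ih =>
    intro S h
    refine ⟨⟨q, h.1, rfl⟩, fun o => (ih o (h.2 o)).mono ?_⟩
    rw [Set.image_sdiff hf, Set.image_singleton]

theorem result_map (π : Protocol (fun q => I (f q)) (fun q => O (f q)) A) (o : ∀ q, O q) :
    (π.map f).result o = π.result fun q => o (f q) := by
  induction π with
  | answer a => rfl
  | query q u next ih => exact ih _

theorem inputs_map (hf : f.Injective) (π : Protocol (fun q => I (f q)) (fun q => O (f q)) A)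
    (idle : ∀ q, I q) (o : ∀ q, O q) (r : ι) :
    (π.map f).inputs idle o (f r) = π.inputs (fun q => idle (f q)) (fun q => o (f q)) r := by
  induction π with
  | answer a => rfl
  | query q u next ih =>
    by_cases hr : r = q
    · subst hr; simp only [inputs_query_self, map]
    · rw [inputs_query_of_ne _ _ hr, map, inputs_query_of_ne _ _ (hf.ne hr), ih]

end
end Protocol

/-! ### Marginals of a single box. -/

namespace NonsignallingBox

/-- The probability of the outputs `o` at the ends in `D`, for the inputs `w`. -/
noncomputable def marginal (X : NonsignallingBox.{v}) (D : Set (Fin 2)) (w : ∀ e, X.In e)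
    (o : ∀ e, X.Out e) : ℝ≥0∞ :=
  (X.corr w).toOuterMeasure {v | ∀ e ∈ D, v e = o e}

variable (X : NonsignallingBox.{v})

theorem marginal_univ (w : ∀ e, X.In e) (o : ∀ e, X.Out e) :
    X.marginal Set.univ w o = X.corr w o := by
  have : {v | ∀ e ∈ Set.univ, v e = o e} = {o} := by
    ext v; simp [funext_iff]
  rw [marginal, this, PMF.toOuterMeasure_apply_singleton]

theorem marginal_empty (w : ∀ e, X.In e) (o : ∀ e, X.Out e) : X.marginal ∅ w o = 1 := by
  rw [marginal, PMF.toOuterMeasure_apply_eq_one_iff]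
  intro v _
  simp

/-- For empty or full `D` this is trivial; for a single end it is the nonsignalling condition, which
enters the proof only here. -/
theorem marginal_congr_in {D : Set (Fin 2)} {w w' : ∀ e, X.In e} (o : ∀ e, X.Out e)
    (h : ∀ e ∈ D, w e = w' e) : X.marginal D w o = X.marginal D w' o := by
  by_cases hD : D = Set.univ
  · subst hD
    rw [funext fun e => h e trivial]
  by_cases hD' : D = ∅
  · subst hD'
    rw [marginal_empty, marginal_empty]
  obtain ⟨e, he⟩ := Set.nonempty_iff_ne_empty.2 hD'
  have hDe : D = {e} := by
    refine Set.eq_singleton_iff_unique_mem.2 ⟨he, fun e' he' => ?_⟩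
    by_contra hne
    refine hD (Set.eq_univ_of_forall fun d => ?_)
    have : d = e ∨ d = e' := by omega
    rcases this with rfl | rfl <;> assumption
  subst hDe
  have key : ∀ w, X.marginal {e} w o =
      ((X.corr w).map fun v => v e).toOuterMeasure {o e} := by
    intro w
    rw [PMF.toOuterMeasure_map_apply, marginal]
    congr 1
    ext v
    simp
  rw [key, key, X.nonsignalling e w w' (h e rfl)]

theorem tsum_marginal_insert {D : Set (Fin 2)} {e : Fin 2} (he : e ∉ D) (w : ∀ e, X.In e)
    (o : ∀ e, X.Out e) :
    ∑' v, X.marginal (insert e D) w (Function.update o e v) = X.marginal D w o := by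
  classical
  simp only [marginal, PMF.toOuterMeasure_apply]
  rw [ENNReal.tsum_comm]
  refine tsum_congr fun z => ?_
  rw [tsum_eq_single (z e)]
  · simp only [Set.indicator_apply, Set.mem_ofPred_eq, Set.forall_mem_insert,
      Function.update_self, true_and]
    congr 1
    refine propext (forall₂_congr fun d hd => ?_)
    rw [Function.update_of_ne (by rintro rfl; exact he hd)]
  · intro v hv
    refine Set.indicator_of_notMem (fun h => hv ?_) _
    simpa using (h e (Set.mem_insert _ _)).symm

end NonsignallingBox

/-! ### Adaptive wirings of boxes: factorisation and extension of partial outcomes. -/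

section Wiring

variable {B : Type} {J : Type} {A : J → Type} {box : B → NonsignallingBox.{v}}

/-- The input at the end `q`, if the agents follow the procedures `π`. -/
noncomputable def wiringInput (owner : B × Fin 2 → J)
    (π : ∀ j, Protocol (fun q : B × Fin 2 => (box q.1).In q.2) (fun q => (box q.1).Out q.2) (A j))
    (w : ∀ q : B × Fin 2, (box q.1).In q.2) (o : ∀ q : B × Fin 2, (box q.1).Out q.2)
    (q : B × Fin 2) : (box q.1).In q.2 :=
  (π (owner q)).inputs w o q

variable (owner : B × Fin 2 → J)

/-- Some end that has not been used can be used next. -/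
theorem exists_wiring_step
    (π : ∀ j, Protocol (fun q : B × Fin 2 => (box q.1).In q.2) (fun q => (box q.1).Out q.2) (A j))
    (w : ∀ q : B × Fin 2, (box q.1).In q.2) {D : Set (B × Fin 2)} (hD : D ≠ Set.univ)
    (hπ : ∀ j, (π j).UsesOnly ({q | owner q = j} \ D)) :
    ∃ q, q ∉ D ∧ ∃ (w' : ∀ q : B × Fin 2, (box q.1).In q.2) (π' : (box q.1).Out q.2 → ∀ j,
        Protocol (fun q : B × Fin 2 => (box q.1).In q.2) (fun q => (box q.1).Out q.2) (A j)),
      (∀ r, r ≠ q → w' r = w r) ∧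
      (∀ v j, (π' v j).UsesOnly ({q | owner q = j} \ insert q D)) ∧
      ∀ o, wiringInput owner (π' (o q)) w' o = wiringInput owner π w o := by
  classical
  by_cases hans : ∀ j, ∃ a, π j = .answer a
  · obtain ⟨q, hq⟩ := (Set.ne_univ_iff_exists_notMem D).1 hD
    refine ⟨q, hq, w, fun _ => π, fun _ _ => rfl, fun _ j => ?_, fun _ => rfl⟩
    obtain ⟨a, ha⟩ := hans j
    change (π j).UsesOnly _
    rw [ha]
    trivial
  · push Not at hans
    obtain ⟨j, hj⟩ := hans
    rcases hπj : π j with a | ⟨q, u, next⟩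
    · exact absurd hπj (hj a)
    have hu := hπ j
    rw [hπj] at hu
    obtain ⟨⟨hqj, hqD⟩, hnext⟩ := hu
    have hne : ∀ v i, (Function.update π j (next v) i).UsesOnly
        ({q | owner q = i} \ insert q D) := by
      intro v i
      by_cases hi : i = j
      · subst hi
        rw [Function.update_self]
        refine (hnext v).mono ?_
        rintro r ⟨⟨h1, h2⟩, h3⟩
        exact ⟨h1, by simpa [not_or] using ⟨h3, h2⟩⟩
      · rw [Function.update_of_ne hi]
        refine (hπ i).mono ?_
        rintro r ⟨h1, h2⟩
        refine ⟨h1, ?_⟩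
        rintro (rfl | h3)
        · exact hi (h1.symm.trans hqj)
        · exact h2 h3
    refine ⟨q, hqD, Function.update w q u, fun v => Function.update π j (next v),
      fun r hr => Function.update_of_ne hr _ _, hne, fun o => funext fun r => ?_⟩
    unfold wiringInput
    by_cases hr : r = q
    · subst hr
      rw [Protocol.inputs_of_notMem _ _ (hne (o r) _) (by simp), Function.update_self]
      have : owner r = j := hqj
      rw [this, hπj, Protocol.inputs_query_self]
    · rw [Protocol.inputs_congr_idle _ _ (Function.update_of_ne hr u w)]
      change Protocol.inputs w o (Function.update π j (next (o q)) (owner r)) r = _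
      by_cases hi : owner r = j
      · rw [hi, hπj, Function.update_self, Protocol.inputs_query_of_ne _ _ hr]
      · rw [Function.update_of_ne hi]

variable [Fintype B]

-- `D` is the set of ends used so far, with inputs `w` and outputs `o₀`. Ends are consumed one at a
-- time in an adaptive order, by induction on the number of unused ends; `π` and `w` are general
-- because the continuation depends on the output just obtained. With `D = ∅` the total weight is 1.
open Classical in
theorem tsum_wiring_weight (n : ℕ) : ∀
    (π : ∀ j, Protocol (fun q : B × Fin 2 => (box q.1).In q.2) (fun q => (box q.1).Out q.2) (A j))
    (w : ∀ q : B × Fin 2, (box q.1).In q.2) (D : Set (B × Fin 2))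
    (o₀ : ∀ q : B × Fin 2, (box q.1).Out q.2), Dᶜ.ncard = n →
    (∀ j, (π j).UsesOnly ({q | owner q = j} \ D)) →
    ∑' o : ∀ q : B × Fin 2, (box q.1).Out q.2, (if (∀ q ∈ D, o q = o₀ q) then
        ∏ b, (box b).corr (fun e => wiringInput owner π w o (b, e)) (fun e => o (b, e)) else 0) =
      ∏ b, (box b).marginal {e | (b, e) ∈ D} (fun e => w (b, e)) (fun e => o₀ (b, e)) := by
  induction n with
  | zero =>
    intro π w D o₀ hn hπ
    have hD : D = Set.univ := by
      rw [Set.ncard_eq_zero] at hn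
      simpa using hn
    subst hD
    rw [tsum_eq_single o₀]
    · rw [if_pos fun _ _ => rfl]
      simp only [Set.mem_univ, Set.ofPred_true, NonsignallingBox.marginal_univ]
      refine Finset.prod_congr rfl fun b _ => ?_
      congr 1
      congr 1
      funext e
      exact Protocol.inputs_of_notMem _ _ (hπ _) (by simp)
    · intro o ho
      exact if_neg fun h => ho (funext fun q => h q trivial)
  | succ n ih =>
    intro π w D o₀ hn hπ
    have hD : D ≠ Set.univ := by
      rintro rfl
      simp at hn
    obtain ⟨q, hq, w', π', hw', hπ', hstep⟩ := exists_wiring_step owner π w hD hπ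
    have hn' : (insert q D)ᶜ.ncard = n := by
      have h1 : Dᶜ = insert q (insert q D)ᶜ := by
        ext r
        by_cases hr : r = q
        · subst hr; simp [hq]
        · simp [hr]
      rw [h1, Set.ncard_insert_of_notMem (by simp)] at hn
      omega
    have e1 : ∀ o : ∀ q : B × Fin 2, (box q.1).Out q.2, (if (∀ q ∈ D, o q = o₀ q) then
        ∏ b, (box b).corr (fun e => wiringInput owner π w o (b, e)) (fun e => o (b, e)) else 0) =
        ∑' v, (if (∀ r ∈ insert q D, o r = Function.update o₀ q v r) then
          ∏ b, (box b).corr (fun e => wiringInput owner (π' v) w' o (b, e))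
            (fun e => o (b, e)) else 0) := by
      intro o
      rw [tsum_eq_single (o q)]
      · rw [hstep]
        congr 1
        simp only [Set.forall_mem_insert, Function.update_self, true_and]
        refine propext (forall₂_congr fun d hd => ?_)
        rw [Function.update_of_ne (by rintro rfl; exact hq hd)]
      · intro v hv
        refine if_neg fun h => hv ?_
        simpa using (h q (Set.mem_insert _ _)).symm
    rw [tsum_congr e1, ENNReal.tsum_comm]
    have e3 : ∀ v, ∑' o : ∀ q : B × Fin 2, (box q.1).Out q.2,
        (if (∀ r ∈ insert q D, o r = Function.update o₀ q v r) then
          ∏ b, (box b).corr (fun e => wiringInput owner (π' v) w' o (b, e))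
            (fun e => o (b, e)) else 0) = _ := fun v => by
      have := ih (π' v) w' (insert q D) (Function.update o₀ q v) hn' (hπ' v)
      refine Eq.trans (tsum_congr fun o => ?_) this
      split_ifs <;> rfl
    rw [tsum_congr e3]
    have e2 : ∀ v, ∏ b, (box b).marginal {e | (b, e) ∈ insert q D} (fun e => w' (b, e))
          (fun e => Function.update o₀ q v (b, e)) =
        (box q.1).marginal (insert q.2 {e | (q.1, e) ∈ D}) (fun e => w' (q.1, e))
          (Function.update (fun e => o₀ (q.1, e)) q.2 v) *
        ∏ b ∈ Finset.univ.erase q.1, (box b).marginal {e | (b, e) ∈ D} (fun e => w (b, e))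
          (fun e => o₀ (b, e)) := by
      intro v
      rw [← Finset.mul_prod_erase _ _ (Finset.mem_univ q.1)]
      congr 1
      · have h1 : {e | (q.1, e) ∈ insert q D} = insert q.2 {e | (q.1, e) ∈ D} := by
          ext e
          simp [Prod.ext_iff]
        rw [h1]
        congr 1
        funext e
        by_cases he : e = q.2
        · subst he; simp
        · rw [Function.update_of_ne he, Function.update_of_ne]
          exact fun h => he (congrArg Prod.snd h)
      · refine Finset.prod_congr rfl fun b hb => ?_
        have hbq : ∀ e, (b, e) ≠ q := fun e h => by
          subst h; simp at hb
        have h1 : {e | (b, e) ∈ insert q D} = {e | (b, e) ∈ D} := by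
          ext e
          simp [hbq]
        rw [h1]
        congr 1
        · funext e; exact hw' _ (hbq e)
        · funext e; exact Function.update_of_ne (hbq e) _ _
    rw [tsum_congr e2, ENNReal.tsum_mul_right,
      NonsignallingBox.tsum_marginal_insert _ (by simpa using hq),
      ← Finset.mul_prod_erase _ _ (Finset.mem_univ q.1)]
    congr 1
    -- Once the output at `q` is summed out, its input can be forgotten by nonsignalling.
    refine NonsignallingBox.marginal_congr_in _ _ fun e he => hw' _ ?_
    intro h
    have he' : (q.1, e) ∈ D := he
    exact hq (h ▸ he')

theorem tsum_wiring_weight_univ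
    (π : ∀ j, Protocol (fun q : B × Fin 2 => (box q.1).In q.2) (fun q => (box q.1).Out q.2) (A j))
    (w : ∀ q : B × Fin 2, (box q.1).In q.2) (hπ : ∀ j, (π j).UsesOnly {q | owner q = j}) :
    ∑' o : ∀ q : B × Fin 2, (box q.1).Out q.2,
      ∏ b, (box b).corr (fun e => wiringInput owner π w o (b, e)) (fun e => o (b, e)) ≤ 1 := by
  by_cases hne : Nonempty (∀ q : B × Fin 2, (box q.1).Out q.2)
  · obtain ⟨o₀⟩ := hne
    have := tsum_wiring_weight owner _ π w ∅ o₀ rfl (by simpa using hπ)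
    simp only [Set.mem_empty_iff_false, false_imp_iff, implies_true, if_true, Set.ofPred_false,
      NonsignallingBox.marginal_empty, Finset.prod_const_one] at this
    exact this.le
  · rw [not_nonempty_iff] at hne
    simp

/-- What the agents in `T` have done with their ends can be extended to all ends, if it is possible
for each box separately. -/
theorem exists_wiring_extension
    (π : ∀ j, Protocol (fun q : B × Fin 2 => (box q.1).In q.2) (fun q => (box q.1).Out q.2) (A j))
    (w : ∀ q : B × Fin 2, (box q.1).In q.2) (hπ : ∀ j, (π j).UsesOnly {q | owner q = j})
    (T : Set J) (o₀ : ∀ q : B × Fin 2, (box q.1).Out q.2)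
    (h : ∀ b, ∃ u v, (box b).corr u v ≠ 0 ∧
      ∀ e, owner (b, e) ∈ T → u e = wiringInput owner π w o₀ (b, e) ∧ v e = o₀ (b, e)) :
    ∃ o : ∀ q : B × Fin 2, (box q.1).Out q.2,
      (∀ b, (box b).corr (fun e => wiringInput owner π w o (b, e)) (fun e => o (b, e)) ≠ 0) ∧
      ∀ j ∈ T, (π j).result o = (π j).result o₀ := by
  classical
  -- The agents in `T` are frozen: they stop at once and their inputs become idle values. The weight
  -- of all completions is then a product of box marginals, and `h` makes each factor nonzero.
  set D : Set (B × Fin 2) := {q | owner q ∈ T} with hD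
  set w' : ∀ q : B × Fin 2, (box q.1).In q.2 := fun q =>
    if owner q ∈ T then wiringInput owner π w o₀ q else w q with hw'
  set π' : ∀ j, Protocol (fun q : B × Fin 2 => (box q.1).In q.2)
      (fun q => (box q.1).Out q.2) (A j) := fun j =>
    if j ∈ T then .answer ((π j).result o₀) else π j with hπ'
  have huses : ∀ j, (π' j).UsesOnly ({q | owner q = j} \ D) := by
    intro j
    by_cases hj : j ∈ T
    · simp only [hπ', hj, if_true]; trivial
    · simp only [hπ', hj, if_false]
      refine (hπ j).mono fun q hq => ⟨hq, fun hq' => hj ?_⟩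
      have : owner q = j := hq
      rwa [← this]
  have hsum := tsum_wiring_weight owner _ π' w' D o₀ rfl huses
  have hne : ∏ b, (box b).marginal {e | (b, e) ∈ D} (fun e => w' (b, e)) (fun e => o₀ (b, e))
      ≠ 0 := by
    refine Finset.prod_ne_zero_iff.2 fun b _ => ?_
    obtain ⟨u, v, huv, hT⟩ := h b
    rw [NonsignallingBox.marginal_congr_in _ _ (w' := u) (fun e he => by
      have he' : owner (b, e) ∈ T := he
      simp only [hw', he', if_true, (hT e he').1]), NonsignallingBox.marginal, Ne,
      PMF.toOuterMeasure_apply_eq_zero_iff, Set.not_disjoint_iff]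
    exact ⟨v, (PMF.mem_support_iff _ _).2 huv, fun e he => (hT e he).2⟩
  rw [← hsum, Ne, ENNReal.tsum_eq_zero, not_forall] at hne
  obtain ⟨o, ho⟩ := hne
  have hoD : ∀ q ∈ D, o q = o₀ q := by
    by_contra hcon
    exact ho (if_neg hcon)
  rw [if_pos hoD, ← Ne, Finset.prod_ne_zero_iff] at ho
  refine ⟨o, fun b => ?_, fun j hj => Protocol.result_congr (hπ j) fun q hq => hoD q ?_⟩
  · have hin : (fun e => wiringInput owner π w o (b, e)) =
        fun e => wiringInput owner π' w' o (b, e) := by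
      funext e
      unfold wiringInput
      by_cases hj : owner (b, e) ∈ T
      · have h1 : π' (owner (b, e)) = .answer ((π (owner (b, e))).result o₀) := if_pos hj
        have h2 : w' (b, e) = wiringInput owner π w o₀ (b, e) := if_pos hj
        rw [h1, Protocol.inputs, h2, wiringInput,
          Protocol.inputs_congr w (hπ _) fun q hq => hoD q ?_]
        have : owner q = owner (b, e) := hq
        rw [hD, Set.mem_ofPred_eq, this]
        exact hj
      · have h1 : π' (owner (b, e)) = π (owner (b, e)) := if_neg hj
        have h2 : w' (b, e) = w (b, e) := if_neg hj
        rw [h1]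
        exact Protocol.inputs_congr_idle _ _ h2.symm
    rw [hin]
    exact ho b (Finset.mem_univ b)
  · have : owner q = j := hq
    rw [hD, Set.mem_ofPred_eq, this]
    exact hj

end Wiring

/-! ### Two copies of the network, with a twist. -/

theorem BipartiteNetwork.eq_of_holder_eq {P : Type} (N : BipartiteNetwork P) {k : N.Res} {p : P}
    {e e' : Fin 2} (h : N.holder k e = p) (h' : N.holder k e' = p) : e = e' := by
  have h0 := N.holder_ne k
  have : ∀ d : Fin 2, d = 0 ∨ d = 1 := by decide
  rcases this e with rfl | rfl <;> rcases this e' with rfl | rfl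
  · rfl
  · exact absurd (h.trans h'.symm) h0
  · exact absurd (h'.trans h.symm) h0
  · rfl

open Classical in
/-- In the network of two copies of everything, the ends that `A` holds are interchanged for the
resources that she shares with `C`. -/
noncomputable def BipartiteNetwork.twist {P : Type} (N : BipartiteNetwork P) (A C : P) (k : N.Res)
    (e : Fin 2) : Fin 2 :=
  if N.holder k e = A ∧ ∃ e', N.holder k e' = C then 1 else 0

/-- The copies `σ p` of the players `p` in `T` share the resources that these players share in the
original network. -/
def BipartiteNetwork.Faithful {P : Type} (N : BipartiteNetwork P) (t : N.Res → Fin 2 → Fin 2)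
    (T : Set P) (σ : P → Fin 2) : Prop :=
  ∀ k, ∃ m, ∀ e, N.holder k e ∈ T → σ (N.holder k e) + t k e = m

/-- `σ p + t k e` is the copy of resource `k` whose end `e` is held by copy `σ p` of its holder `p`.
Only resources with both ends in `T` impose a condition. -/
theorem BipartiteNetwork.faithful_of_forall {P : Type} (N : BipartiteNetwork P)
    {t : N.Res → Fin 2 → Fin 2} {T : Set P} {σ : P → Fin 2}
    (h : ∀ k e e', e ≠ e' → N.holder k e ∈ T → N.holder k e' ∈ T →
      σ (N.holder k e) + t k e = σ (N.holder k e') + t k e') : N.Faithful t T σ := by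
  intro k
  by_cases hk : ∃ e, N.holder k e ∈ T
  · obtain ⟨e, he⟩ := hk
    refine ⟨σ (N.holder k e) + t k e, fun e' he' => ?_⟩
    by_cases hee : e' = e
    · rw [hee]
    · exact h k e' e hee he' he
  · exact ⟨0, fun e he => absurd ⟨e, he⟩ hk⟩

section
variable {P : Type} (N : BipartiteNetwork P) {A B C : P}

theorem BipartiteNetwork.faithful_singleton (t : N.Res → Fin 2 → Fin 2) (p : P) (σ : P → Fin 2) :
    N.Faithful t {p} σ :=
  N.faithful_of_forall fun _ _ _ hne he he' => absurd (N.eq_of_holder_eq he he') hne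

/-- A resource between `A` and `B` does not reach `C`, so it is not twisted. -/
theorem BipartiteNetwork.faithful_twist_left (hAC : A ≠ C) (hBC : B ≠ C) :
    N.Faithful (N.twist A C) {A, B} 0 := by
  have key : ∀ k e e', e ≠ e' → N.holder k e ∈ ({A, B} : Set P) → N.holder k e' ∈ ({A, B} : Set P) →
      N.twist A C k e = 0 := by
    intro k e e' hne he he'
    refine if_neg ?_
    rintro ⟨h1, d, hd⟩
    have : d = e ∨ d = e' := by omega
    rcases this with rfl | rfl
    · exact hAC (h1.symm.trans hd)
    · rcases he' with h | h
      · exact hAC (h.symm.trans hd)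
      · exact hBC (h.symm.trans hd)
  refine N.faithful_of_forall fun k e e' hne he he' => ?_
  rw [key k e e' hne he he', key k e' e hne.symm he' he]
  rfl

theorem BipartiteNetwork.faithful_twist_right (hAB : A ≠ B) (hAC : A ≠ C) :
    N.Faithful (N.twist A C) {B, C} 0 := by
  have key : ∀ k e, N.holder k e ∈ ({B, C} : Set P) → N.twist A C k e = 0 := by
    intro k e he
    refine if_neg ?_
    rintro ⟨h1, -⟩
    rcases he with h | h
    · exact hAB (h1.symm.trans h)
    · exact hAC (h1.symm.trans h)
  refine N.faithful_of_forall fun k e e' hne he he' => ?_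
  rw [key k e he, key k e' he']
  rfl

-- At the end of `A` the shift from `σ` and the twist cancel, as 1 + 1 = 0 in `Fin 2`.
open Classical in
theorem BipartiteNetwork.faithful_twist_outer (hAC : A ≠ C) :
    N.Faithful (N.twist A C) {A, C} (fun p => if p = A then 1 else 0) := by
  have key : ∀ k e e', e ≠ e' → N.holder k e ∈ ({A, C} : Set P) → N.holder k e' ∈ ({A, C} : Set P) →
      (if N.holder k e = A then 1 else 0) + N.twist A C k e = 0 := by
    intro k e e' hne he he'
    rcases he with h | h
    · have : N.holder k e' = C := by
        rcases he' with h' | h'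
        · exact absurd (N.eq_of_holder_eq h h') hne
        · exact h'
      rw [if_pos h, BipartiteNetwork.twist, if_pos ⟨h, e', this⟩]
      rfl
    · have h' : N.holder k e ≠ A := fun h' => hAC (h'.symm.trans h)
      rw [if_neg h', BipartiteNetwork.twist, if_neg fun h'' => h' h''.1]
      rfl
  refine N.faithful_of_forall fun k e e' hne he he' => ?_
  rw [key k e e' hne he he', key k e' e hne.symm he' he]

end

/-- Common interface for both kinds of resources: `h` makes the copies of one player independent,
`h'` carries outcomes of the doubled network back along faithful choices of copies. -/
theorem BipartitePossibility.of_faithful {P : Type} {G : NonlocalGame P} (N : BipartiteNetwork P)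
    {R : (∀ p, G.In p) → (∀ p, G.Out p) → Prop}
    (nosig : ∀ (T : Set P) (x x' : ∀ p, G.In p), (∀ p ∈ T, x p = x' p) → ∀ a, R x a →
      ∃ a', R x' a' ∧ ∀ p ∈ T, a' p = a p)
    (Q : (∀ p, G.In p) → (N.Res → Fin 2 → Fin 2) → (Fin 2 → ∀ p, G.Out p) → Prop)
    (h : ∀ x t A a b, R x a → R x b → ∃ q, Q x t q ∧ q 0 A = a A ∧ q 1 A = b A)
    (h' : ∀ x t q, Q x t q → ∀ T σ, N.Faithful t T σ → ∃ a, R x a ∧ ∀ p ∈ T, a p = q (σ p) p) :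
    BipartitePossibility G R where
  nosig := nosig
  inflation x A B C hAB hAC hBC := by
    refine ⟨Q x (N.twist A C), h x _ A, fun q hq => ⟨?_, ?_, ?_⟩⟩
    · obtain ⟨a, ha, haT⟩ := h' x _ q hq _ _ (N.faithful_twist_left hAC hBC)
      exact ⟨a, ha, haT A (by simp), haT B (by simp)⟩
    · obtain ⟨a, ha, haT⟩ := h' x _ q hq _ _ (N.faithful_twist_right hAB hAC)
      exact ⟨a, ha, haT B (by simp), haT C (by simp)⟩
    · obtain ⟨a, ha, haT⟩ := h' x _ q hq _ _ (N.faithful_twist_outer hAC)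
      refine ⟨a, ha, ?_, ?_⟩
      · simpa using haT A (by simp)
      · simpa [hAC.symm] using haT C (by simp)

/-! ### Box strategies. -/

namespace BoxStrategy

variable {P : Type} {G : NonlocalGame P} (S : BoxStrategy.{u, v} G)

theorem tsum_behaviour_le_one (ω : S.Ω) (x : ∀ p, G.In p) : ∑' a, S.behaviour ω x a ≤ 1 := by
  classical
  unfold behaviour
  rw [ENNReal.tsum_comm]
  refine le_trans (ENNReal.tsum_le_tsum fun o => ?_)
    (tsum_wiring_weight_univ (box := S.box) (fun q => S.net.holder q.1 q.2)
      (fun p => S.protocol p ω (x p)) (fun _ => Classical.arbitrary _)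
      (fun p => S.usesOnly p ω (x p)))
  rw [tsum_eq_single fun p => (S.protocol p ω (x p)).result o]
  · rw [if_pos fun _ => rfl]
    exact le_rfl
  · intro a ha
    exact if_neg fun h => ha (funext fun p => (h p).symm)

/-- The joint output `a` is possible. -/
def Possible (ω : S.Ω) (x : ∀ p, G.In p) (a : ∀ p, G.Out p) : Prop :=
  ∃ o : ∀ q : S.net.End, (S.box q.1).Out q.2,
    (∀ k, (S.box k).corr (fun e => S.inputAt ω x o (k, e)) (fun e => o (k, e)) ≠ 0) ∧
    ∀ p, (S.protocol p ω (x p)).result o = a p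

theorem behaviour_ne_zero_iff (ω : S.Ω) (x : ∀ p, G.In p) (a : ∀ p, G.Out p) :
    S.behaviour ω x a ≠ 0 ↔ S.Possible ω x a := by
  classical
  unfold behaviour Possible
  rw [Ne, ENNReal.tsum_eq_zero, not_forall]
  refine exists_congr fun o => ?_
  rw [ite_eq_right_iff, Classical.not_imp, and_comm, weight, ← Ne, Finset.prod_ne_zero_iff]
  simp

theorem possible_nosig (ω : S.Ω) (T : Set P) (x x' : ∀ p, G.In p) (hx : ∀ p ∈ T, x p = x' p)
    (a : ∀ p, G.Out p) (ha : S.Possible ω x a) :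
    ∃ a', S.Possible ω x' a' ∧ ∀ p ∈ T, a' p = a p := by
  obtain ⟨o, ho, hoa⟩ := ha
  obtain ⟨o', ho', hoT⟩ := exists_wiring_extension (box := S.box)
    (fun q => S.net.holder q.1 q.2) (fun p => S.protocol p ω (x' p))
    (fun _ => Classical.arbitrary _) (fun p => S.usesOnly p ω (x' p)) T o fun k =>
      ⟨_, _, ho k, fun e he => ⟨by
        unfold inputAt wiringInput
        rw [hx _ he], rfl⟩⟩
  refine ⟨fun p => (S.protocol p ω (x' p)).result o', ⟨o', ho', fun _ => rfl⟩, fun p hp => ?_⟩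
  refine (hoT p hp).trans ?_
  rw [← hx p hp, hoa]

section Inflation

variable (t : S.net.Res → Fin 2 → Fin 2)

/-- The end `q` that copy `m` of its holder has in the network of two copies of everything. -/
def copyEnd (m : Fin 2) (q : S.net.End) : (S.net.Res × Fin 2) × Fin 2 :=
  ((q.1, m + t q.1 q.2), q.2)

/-- The copy of a player that holds an end in the network of two copies of everything. -/
def copyOwner (q : (S.net.Res × Fin 2) × Fin 2) : P × Fin 2 :=
  (S.net.holder q.1.1 q.2, q.1.2 + t q.1.1 q.2)

/-- The procedures in the network of two copies of everything. -/
noncomputable def copyProtocol (ω : S.Ω) (x : ∀ p, G.In p) (j : P × Fin 2) :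
    Protocol (fun q : (S.net.Res × Fin 2) × Fin 2 => (S.box q.1.1).In q.2)
      (fun q => (S.box q.1.1).Out q.2) (G.Out j.1) :=
  Protocol.map (I := fun q : (S.net.Res × Fin 2) × Fin 2 => (S.box q.1.1).In q.2)
    (O := fun q => (S.box q.1.1).Out q.2) (S.copyEnd t j.2) (S.protocol j.1 ω (x j.1))

theorem copyEnd_injective (m : Fin 2) : (S.copyEnd t m).Injective := by
  rintro ⟨k, e⟩ ⟨k', e'⟩ h
  simp only [copyEnd, Prod.mk.injEq] at h
  exact Prod.ext h.1.1 h.2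

theorem add_add_cancel_fin_two (m n : Fin 2) : m + n + n = m := by
  revert m n; decide

theorem apply_copy_congr {K : Type} {γ : K → Fin 2 → Type v}
    (g : ∀ q : (K × Fin 2) × Fin 2, γ q.1.1 q.2) {m n : Fin 2} (h : m = n) (k : K) (e : Fin 2) :
    (g ((k, m), e) : γ k e) = g ((k, n), e) := by
  rw [h]

theorem copyOwner_copyEnd (m : Fin 2) (q : S.net.End) :
    S.copyOwner t (S.copyEnd t m q) = (S.net.holder q.1 q.2, m) := by
  simp [copyOwner, copyEnd, add_add_cancel_fin_two]

theorem copyProtocol_usesOnly (ω : S.Ω) (x : ∀ p, G.In p) (j : P × Fin 2) :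
    (S.copyProtocol t ω x j).UsesOnly {q | S.copyOwner t q = j} := by
  refine (Protocol.UsesOnly.map (S.copyEnd_injective t j.2) (S.usesOnly j.1 ω (x j.1))).mono ?_
  rintro _ ⟨q, hq, rfl⟩
  have hq' : S.net.holder q.1 q.2 = j.1 := hq
  rw [Set.mem_ofPred_eq, copyOwner_copyEnd, hq']

theorem wiringInput_copyEnd (ω : S.Ω) (x : ∀ p, G.In p)
    (o : ∀ q : (S.net.Res × Fin 2) × Fin 2, (S.box q.1.1).Out q.2) (m : Fin 2) (q : S.net.End) :
    wiringInput (box := fun b : S.net.Res × Fin 2 => S.box b.1) (S.copyOwner t)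
      (S.copyProtocol t ω x) (fun _ => Classical.arbitrary _) o (S.copyEnd t m q) =
    S.inputAt ω x (fun r => o (S.copyEnd t m r)) q := by
  unfold wiringInput
  rw [copyOwner_copyEnd]
  exact Protocol.inputs_map (I := fun q : (S.net.Res × Fin 2) × Fin 2 => (S.box q.1.1).In q.2)
    (O := fun q => (S.box q.1.1).Out q.2) (S.copyEnd_injective t m) _ _ o q

theorem result_copyProtocol (ω : S.Ω) (x : ∀ p, G.In p)
    (o : ∀ q : (S.net.Res × Fin 2) × Fin 2, (S.box q.1.1).Out q.2) (j : P × Fin 2) :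
    (S.copyProtocol t ω x j).result o =
      (S.protocol j.1 ω (x j.1)).result fun r => o (S.copyEnd t j.2 r) :=
  Protocol.result_map (I := fun q : (S.net.Res × Fin 2) × Fin 2 => (S.box q.1.1).In q.2)
    (O := fun q => (S.box q.1.1).Out q.2) _ o

/-- The joint output `a` of two copies of every player is possible in the network of two copies of
everything. -/
def CopiesPossible (ω : S.Ω) (x : ∀ p, G.In p) (a : Fin 2 → ∀ p, G.Out p) : Prop :=
  ∃ o : ∀ q : (S.net.Res × Fin 2) × Fin 2, (S.box q.1.1).Out q.2,
    (∀ b : S.net.Res × Fin 2, (S.box b.1).corr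
      (fun e => wiringInput (box := fun b : S.net.Res × Fin 2 => S.box b.1) (S.copyOwner t)
        (S.copyProtocol t ω x) (fun _ => Classical.arbitrary _) o (b, e))
      (fun e => o (b, e)) ≠ 0) ∧
    ∀ j, (S.copyProtocol t ω x j).result o = a j.2 j.1

theorem copiesPossible_of_possible (ω : S.Ω) (x : ∀ p, G.In p) (A : P) (a b : ∀ p, G.Out p)
    (ha : S.Possible ω x a) (hb : S.Possible ω x b) :
    ∃ q, S.CopiesPossible t ω x q ∧ q 0 A = a A ∧ q 1 A = b A := by
  classical
  obtain ⟨o, ho, hoa⟩ := ha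
  obtain ⟨o', ho', hob⟩ := hb
  set oo : Fin 2 → ∀ q : S.net.End, (S.box q.1).Out q.2 := fun m => if m = 0 then o else o'
    with hoo
  have hoo' : ∀ m k, (S.box k).corr (fun e => S.inputAt ω x (oo m) (k, e))
      (fun e => oo m (k, e)) ≠ 0 := by
    intro m k
    by_cases hm : m = 0
    · simpa only [hoo, hm, if_true] using ho k
    · simpa only [hoo, hm, if_false] using ho' k
  -- Every end takes its output from the run, `o` or `o'`, assigned to the copy of the player that
  -- holds it.
  set o₀ : ∀ q : (S.net.Res × Fin 2) × Fin 2, (S.box q.1.1).Out q.2 := fun q =>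
    oo (q.1.2 + t q.1.1 q.2) (q.1.1, q.2) with ho₀
  have hoc : ∀ m, (fun r => o₀ (S.copyEnd t m r)) = oo m := by
    intro m
    funext r
    simp only [ho₀, copyEnd, add_add_cancel_fin_two]
  obtain ⟨w, hw, hwT⟩ := exists_wiring_extension
    (box := fun b : S.net.Res × Fin 2 => S.box b.1) (S.copyOwner t) (S.copyProtocol t ω x)
    (fun _ => Classical.arbitrary _) (S.copyProtocol_usesOnly t ω x) {j | j.1 = A} o₀ (by
      rintro ⟨k, m⟩
      -- A box has at most one end at a copy of `A`, so the run of that copy is a witness, and the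
      -- other end is unconstrained.
      by_cases hk : ∃ e, S.net.holder k e = A
      · obtain ⟨e, he⟩ := hk
        refine ⟨_, _, hoo' (m + t k e) k, fun e' he' => ?_⟩
        obtain rfl := S.net.eq_of_holder_eq he he'
        refine ⟨?_, rfl⟩
        have := S.wiringInput_copyEnd t ω x o₀ (m + t k e) (k, e)
        rw [hoc] at this
        exact this.symm.trans (apply_copy_congr (γ := fun k e => (S.box k).In e) (wiringInput
          (box := fun b : S.net.Res × Fin 2 => S.box b.1) (S.copyOwner t)
          (S.copyProtocol t ω x) (fun _ => Classical.arbitrary _) o₀)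
          (add_add_cancel_fin_two m (t k e)) k e)
      · exact ⟨_, _, hoo' 0 k, fun e he => absurd ⟨e, he⟩ hk⟩)
  refine ⟨fun m p => (S.copyProtocol t ω x (p, m)).result w, ⟨w, hw, fun _ => rfl⟩, ?_, ?_⟩
  · refine (hwT (A, 0) rfl).trans ?_
    rw [result_copyProtocol, hoc]
    exact hoa A
  · refine (hwT (A, 1) rfl).trans ?_
    rw [result_copyProtocol, hoc]
    exact hob A

theorem possible_of_copiesPossible (ω : S.Ω) (x : ∀ p, G.In p) (a : Fin 2 → ∀ p, G.Out p)
    (ha : S.CopiesPossible t ω x a) (T : Set P) (σ : P → Fin 2) (hσ : S.net.Faithful t T σ) :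
    ∃ b, S.Possible ω x b ∧ ∀ p ∈ T, b p = a (σ p) p := by
  obtain ⟨o, ho, hoa⟩ := ha
  set o₀ : ∀ q : S.net.End, (S.box q.1).Out q.2 := fun q =>
    o (S.copyEnd t (σ (S.net.holder q.1 q.2)) q) with ho₀
  have hends : ∀ p, ∀ q ∈ S.net.ends p, o (S.copyEnd t (σ p) q) = o₀ q := by
    rintro p q rfl
    rfl
  obtain ⟨o', ho', hoT⟩ := exists_wiring_extension (box := S.box)
    (fun q => S.net.holder q.1 q.2) (fun p => S.protocol p ω (x p))
    (fun _ => Classical.arbitrary _) (fun p => S.usesOnly p ω (x p)) T o₀ fun k => by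
      -- All ends of `k` in `T` belong to copy `m` of the box, so its outcome in the doubled network
      -- is the witness.
      obtain ⟨m, hm⟩ := hσ k
      refine ⟨_, _, ho (k, m), fun e he => ?_⟩
      constructor
      · have h1 := S.wiringInput_copyEnd t ω x o (σ (S.net.holder k e)) (k, e)
        have h2 : S.inputAt ω x (fun r => o (S.copyEnd t (σ (S.net.holder k e)) r)) (k, e) =
            S.inputAt ω x o₀ (k, e) := by
          unfold inputAt
          rw [Protocol.inputs_congr _ (S.usesOnly _ ω _) (hends (S.net.holder k e))]
        exact (apply_copy_congr (γ := fun k e => (S.box k).In e) (wiringInput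
          (box := fun b : S.net.Res × Fin 2 => S.box b.1) (S.copyOwner t)
          (S.copyProtocol t ω x) (fun _ => Classical.arbitrary _) o)
          (hm e he) k e).symm.trans (h1.trans h2)
      · exact (apply_copy_congr (γ := fun k e => (S.box k).Out e) o (hm e he) k e).symm
  refine ⟨fun p => (S.protocol p ω (x p)).result o', ⟨o', ho', fun _ => rfl⟩, fun p hp => ?_⟩
  refine (hoT p hp).trans ?_
  rw [← hoa (p, σ p), result_copyProtocol]
  exact (Protocol.result_congr (S.usesOnly p ω (x p)) (hends p)).symm

end Inflation

theorem bipartitePossibility (ω : S.Ω) :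
    BipartitePossibility G fun x a => S.behaviour ω x a ≠ 0 := by
  simp only [behaviour_ne_zero_iff]
  exact .of_faithful S.net (S.possible_nosig ω) (fun x t => S.CopiesPossible t ω x)
    (fun x t A a b => S.copiesPossible_of_possible t ω x A a b)
    (fun x t q => S.possible_of_copiesPossible t ω x q)

end BoxStrategy

theorem BoxStrategy.not_wins_mainGame (S : BoxStrategy.{u, v} mainGame) : ¬ S.Wins := by
  intro h
  obtain ⟨ω, hω⟩ := NonlocalGame.Won.exists_forall_rule S.tsum_behaviour_le_one h
  exact (S.bipartitePossibility ω).mainGame_false hω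

/-! ### Strategies in nonsignalling theories. -/

namespace Devices

variable {P : Type} [Fintype P] {G : NonlocalGame P} {Ω : Type u} (T : Devices G Ω) {n : ℕ}

open Classical in
/-- The number that the theory assigns to the joint output `a` of the players, when nothing is
copied. -/
noncomputable def probability (ω : P → Ω) (x : ∀ p, G.In p) (a : ∀ p, G.Out p) : ℝ :=
  ∑ s : ∀ q : T.net.End, T.Sys q.1 q.2,
    (∏ k, T.state k (fun e => s (k, e))) * ∏ p, T.effect p (ω p) (x p) (a p) (fun q => s q.1)

theorem circuit_one (ω : Fin n → P → Ω) (x : Fin n → ∀ p, G.In p) (a : Fin n → ∀ p, G.Out p) :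
    T.circuit (fun _ _ => 1) ω x a = ∏ m, T.probability (ω m) (x m) (a m) := by
  classical
  unfold circuit probability
  rw [Finset.prod_univ_sum, Fintype.piFinset_univ]
  simp only [Equiv.Perm.coe_one, id_eq, ← Finset.prod_mul_distrib]

open Classical in
/-- The contraction of all states with the effects of the players in `K`, where the systems of the
other players are discarded. -/
noncomputable def marginal (K : Set P) (link : T.net.Res → Fin 2 → Equiv.Perm (Fin n))
    (ω : P → Ω) (x : ∀ p, G.In p) (a : Fin n → ∀ p, G.Out p) : ℝ :=
  ∑ s : Fin n → ∀ q : T.net.End, T.Sys q.1 q.2,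
    (∏ m, ∏ k, T.state k (fun e => s (link k e m) (k, e))) *
      ∏ m, ∏ p, if p ∈ K then T.effect p (ω p) (x p) (a m p) (fun q => s m q.1) else
        ∏ q : T.net.ends p, T.discard q.1.1 q.1.2 (s m q.1)

variable {T}

-- By `effect_sum`, summing over the outputs of the players outside `K` discards their systems.
open Classical in
theorem IsNonsignalling.sum_circuit (hT : T.IsNonsignalling) (K : Set P)
    (link : T.net.Res → Fin 2 → Equiv.Perm (Fin n)) (ω : P → Ω) (x : ∀ p, G.In p)
    (a : Fin n → ∀ p, G.Out p) :
    ∑ b : Fin n → ∀ p, G.Out p, (if ∀ m, ∀ p ∈ K, b m p = a m p then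
      T.circuit link (fun _ => ω) (fun _ => x) b else 0) = T.marginal K link ω x a := by
  have hfilter : Finset.univ.filter (fun b : Fin n → ∀ p, G.Out p =>
      ∀ m, ∀ p ∈ K, b m p = a m p) = Fintype.piFinset fun m =>
        Fintype.piFinset fun p => if p ∈ K then {a m p} else Finset.univ := by
    ext b
    simp only [Finset.mem_filter, Finset.mem_univ, true_and, Fintype.mem_piFinset]
    refine forall₂_congr fun m p => ?_
    by_cases hp : p ∈ K <;> simp [hp]
  rw [← Finset.sum_filter, hfilter]
  unfold circuit marginal
  rw [Finset.sum_comm]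
  refine Finset.sum_congr rfl fun s _ => ?_
  rw [← Finset.mul_sum]
  congr 1
  rw [← Finset.prod_univ_sum (fun m => Fintype.piFinset fun p =>
    if p ∈ K then {a m p} else Finset.univ) (fun m (c : ∀ p, G.Out p) =>
      ∏ p, T.effect p (ω p) (x p) (c p) (fun q => s m q.1))]
  refine Finset.prod_congr rfl fun m _ => ?_
  rw [← Finset.prod_univ_sum (fun p => if p ∈ K then {a m p} else Finset.univ)
    (fun p c => T.effect p (ω p) (x p) c (fun q => s m q.1))]
  refine Finset.prod_congr rfl fun p _ => ?_
  by_cases hp : p ∈ K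
  · simp [hp]
  · simp only [hp, if_false]
    exact hT.effect_sum p (ω p) (x p) fun q => s m q.1

theorem marginal_congr {K : Set P} (link : T.net.Res → Fin 2 → Equiv.Perm (Fin n))
    (ω : P → Ω) {x x' : ∀ p, G.In p} (h : ∀ p ∈ K, x p = x' p) (a : Fin n → ∀ p, G.Out p) :
    T.marginal K link ω x a = T.marginal K link ω x' a := by
  unfold marginal
  refine Finset.sum_congr rfl fun s _ => ?_
  congr 1
  refine Finset.prod_congr rfl fun m _ => Finset.prod_congr rfl fun p _ => ?_
  by_cases hp : p ∈ K
  · rw [if_pos hp, if_pos hp, h p hp]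
  · rw [if_neg hp, if_neg hp]

/-- Only the links between the players in `K` matter, up to renaming the copies of players and
resources. -/
theorem marginal_relabel {K : Set P} {link link' : T.net.Res → Fin 2 → Equiv.Perm (Fin n)}
    (σ : P → Equiv.Perm (Fin n)) (ρ : T.net.Res → Equiv.Perm (Fin n))
    (h : ∀ k e, T.net.holder k e ∈ K →
      link' k e * ρ k = σ (T.net.holder k e) * link k e)
    (ω : P → Ω) (x : ∀ p, G.In p) (a : Fin n → ∀ p, G.Out p) :
    T.marginal K link' ω x a = T.marginal K link ω x fun m p => a (σ p m) p := by
  classical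
  -- The sum is reindexed by renaming the copies of the system at each end. At ends held in `K` this
  -- is `σ`; at the others only the product of the discards over all copies occurs, which every
  -- permutation preserves.
  set τ : T.net.End → Equiv.Perm (Fin n) := fun q =>
    link' q.1 q.2 * ρ q.1 * (link q.1 q.2)⁻¹ with hτ
  have hτK : ∀ q, T.net.holder q.1 q.2 ∈ K → τ q = σ (T.net.holder q.1 q.2) := by
    intro q hq
    rw [hτ]
    simp only
    rw [h _ _ hq, mul_inv_cancel_right]
  have hτl : ∀ k e m, τ (k, e) (link k e m) = link' k e (ρ k m) := by
    intro k e m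
    simp [hτ]
  let E : (Fin n → ∀ q : T.net.End, T.Sys q.1 q.2) ≃
      (Fin n → ∀ q : T.net.End, T.Sys q.1 q.2) :=
    { toFun := fun s m q => s (τ q m) q
      invFun := fun s m q => s ((τ q)⁻¹ m) q
      left_inv := fun s => by simp
      right_inv := fun s => by simp }
  unfold marginal
  refine Fintype.sum_equiv E _ _ fun s => ?_
  congr 1
  · rw [Finset.prod_comm, Finset.prod_comm (s := Finset.univ (α := Fin n))]
    refine Finset.prod_congr rfl fun k _ => ?_
    rw [← Equiv.prod_comp (ρ k)]
    refine Finset.prod_congr rfl fun m _ => ?_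
    congr 1
    funext e
    change _ = s (τ (k, e) (link k e m)) (k, e)
    rw [hτl]
  · rw [Finset.prod_comm, Finset.prod_comm (s := Finset.univ (α := Fin n))]
    refine Finset.prod_congr rfl fun p _ => ?_
    by_cases hp : p ∈ K
    · simp only [if_pos hp]
      rw [← Equiv.prod_comp (σ p)]
      refine Finset.prod_congr rfl fun m _ => ?_
      congr 1
      funext q
      change _ = s (τ q.1 m) q.1
      have hq : T.net.holder q.1.1 q.1.2 = p := q.2
      rw [hτK _ (by rwa [hq]), hq]
    · simp only [if_neg hp]
      rw [Finset.prod_comm, Finset.prod_comm (s := Finset.univ (α := Fin n))]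
      refine Finset.prod_congr rfl fun q _ => ?_
      exact (Equiv.prod_comp (τ q.1) fun m => T.discard q.1.1 q.1.2 (s m q.1)).symm

/-- Otherwise the common marginal on `K`, computed with `link`, would vanish. Computed with `link'`
it is a sum of nonnegative terms, one of which is the circuit of `a`. -/
theorem IsNonsignalling.exists_circuit_ne_zero (hT : T.IsNonsignalling) {K : Set P}
    {link link' : T.net.Res → Fin 2 → Equiv.Perm (Fin n)}
    (σ : P → Equiv.Perm (Fin n)) (ρ : T.net.Res → Equiv.Perm (Fin n))
    (h : ∀ k e, T.net.holder k e ∈ K →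
      link' k e * ρ k = σ (T.net.holder k e) * link k e)
    (ω : P → Ω) {x x' : ∀ p, G.In p} (hx : ∀ p ∈ K, x p = x' p) (a : Fin n → ∀ p, G.Out p)
    (ha : T.circuit link' (fun _ => ω) (fun _ => x) a ≠ 0) :
    ∃ b, T.circuit link (fun _ => ω) (fun _ => x') b ≠ 0 ∧ ∀ m, ∀ p ∈ K, b m p = a (σ p m) p := by
  classical
  by_contra! hcon
  have h0 : T.marginal K link' ω x a = 0 := by
    rw [marginal_relabel σ ρ h, marginal_congr link ω hx, ← hT.sum_circuit]
    refine Finset.sum_eq_zero fun b _ => ?_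
    split_ifs with hb
    · by_contra hne
      obtain ⟨m, p, hp, hmp⟩ := hcon b hne
      exact hmp (hb m p hp)
    · rfl
  rw [← hT.sum_circuit, Finset.sum_eq_zero_iff_of_nonneg fun b _ => by
    split_ifs
    · exact hT.circuit_nonneg _ _ _ _ _
    · exact le_rfl] at h0
  have := h0 a (Finset.mem_univ _)
  rw [if_pos fun _ _ _ => rfl] at this
  exact ha this

theorem circuit_single (ω : P → Ω) (x : ∀ p, G.In p) (a : ∀ p, G.Out p) :
    T.circuit (n := 1) (fun _ _ => 1) (fun _ => ω) (fun _ => x) (fun _ => a) =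
      T.probability ω x a := by
  rw [circuit_one, Finset.univ_unique, Finset.prod_singleton]

theorem IsNonsignalling.probability_nonneg (hT : T.IsNonsignalling) (ω : P → Ω)
    (x : ∀ p, G.In p) (a : ∀ p, G.Out p) : 0 ≤ T.probability ω x a := by
  rw [← circuit_single]
  exact hT.circuit_nonneg _ _ _ _ _

open Classical in
theorem IsNonsignalling.sum_probability (hT : T.IsNonsignalling) (ω : P → Ω)
    (x : ∀ p, G.In p) : ∑ a : ∀ p, G.Out p, T.probability ω x a = 1 := by
  let E : (∀ q : T.net.End, T.Sys q.1 q.2) ≃ ∀ k e, T.Sys k e :=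
    { toFun := fun s k e => s (k, e)
      invFun := fun s q => s q.1 q.2
      left_inv := fun _ => rfl
      right_inv := fun _ => rfl }
  unfold probability
  rw [Finset.sum_comm]
  have h1 : ∀ s : ∀ q : T.net.End, T.Sys q.1 q.2,
      ∑ a : ∀ p, G.Out p, (∏ k, T.state k (fun e => s (k, e))) *
        ∏ p, T.effect p (ω p) (x p) (a p) (fun q => s q.1) =
      ∏ k, (T.state k (E s k) * ∏ e, T.discard k e (E s k e)) := by
    intro s
    rw [← Finset.mul_sum, Finset.prod_mul_distrib]
    congr 1
    have h2 := Finset.prod_univ_sum (fun p => (Finset.univ : Finset (G.Out p)))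
      (fun p c => T.effect p (ω p) (x p) c (fun q => s q.1))
    rw [Fintype.piFinset_univ] at h2
    rw [← h2]
    simp only [hT.effect_sum]
    -- The discards are regrouped from players to resources, so that the sum splits into the norms
    -- of the states.
    exact (Fintype.prod_fiberwise (fun q : T.net.End => T.net.holder q.1 q.2)
      fun q => T.discard q.1 q.2 (s q)).trans (Fintype.prod_prod_type _)
  rw [Finset.sum_congr rfl fun s _ => h1 s,
    Fintype.sum_equiv E _ (fun s => ∏ k, (T.state k (s k) * ∏ e, T.discard k e (s k e)))
      fun _ => rfl]
  have h3 := Finset.prod_univ_sum (fun k => (Finset.univ : Finset (∀ e, T.Sys k e)))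
    (fun k s => T.state k s * ∏ e, T.discard k e (s e))
  rw [Fintype.piFinset_univ] at h3
  rw [← h3]
  exact Finset.prod_eq_one fun k _ => hT.state_norm k

theorem IsNonsignalling.exists_probability_ne_zero (hT : T.IsNonsignalling) (ω : P → Ω)
    (K : Set P) (x x' : ∀ p, G.In p) (hx : ∀ p ∈ K, x p = x' p) (a : ∀ p, G.Out p)
    (ha : T.probability ω x a ≠ 0) :
    ∃ b, T.probability ω x' b ≠ 0 ∧ ∀ p ∈ K, b p = a p := by
  rw [← circuit_single] at ha
  obtain ⟨b, hb, hbK⟩ := hT.exists_circuit_ne_zero (link := fun _ _ => 1) 1 1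
    (fun _ _ _ => rfl) ω hx _ ha
  rw [circuit_one, Finset.univ_unique, Finset.prod_singleton] at hb
  exact ⟨b default, hb, hbK default⟩

theorem IsNonsignalling.bipartitePossibility (hT : T.IsNonsignalling) (ω : P → Ω) :
    BipartitePossibility G fun x a => T.probability ω x a ≠ 0 := by
  refine .of_faithful T.net (fun K x x' hx a => hT.exists_probability_ne_zero ω K x x' hx a)
    (fun x t q => T.circuit (n := 2) (fun k e => Equiv.addRight (t k e)) (fun _ => ω)
      (fun _ => x) q ≠ 0) ?_ ?_
  · intro x t A a b ha hb
    -- Since `A` holds at most one end of each resource, renaming the copies of resource `k` by `c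
    -- k` undoes the twist as far as she can see.
    choose c hc using T.net.faithful_singleton t A 0
    obtain ⟨q, hq, hqA⟩ := hT.exists_circuit_ne_zero (K := {A}) (link' := fun _ _ => 1)
      (link := fun k e => Equiv.addRight (t k e)) 1 (fun k => Equiv.addRight (c k))
      (fun k e he => by
        rw [← hc k e he]
        simp) ω (x := x) (fun _ _ => rfl) ![a, b] (by
        rw [circuit_one, Fin.prod_univ_two]
        exact mul_ne_zero ha hb)
    exact ⟨q, hq, hqA 0 A rfl, hqA 1 A rfl⟩
  · intro x t q hq K σ hσ
    choose c hc using hσ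
    obtain ⟨b, hb, hbK⟩ := hT.exists_circuit_ne_zero (K := K) (link := fun _ _ => 1)
      (fun p => Equiv.addRight (σ p)) (fun k => Equiv.addRight (c k))
      (fun k e he => by
        rw [← hc k e he]
        -- Shifting by `i + j` and then by `j` is shifting by `i` in `Fin 2`.
        generalize σ (T.net.holder k e) = i, t k e = j
        revert i j
        decide) ω (fun _ _ => rfl) q hq
    rw [circuit_one, Fin.prod_univ_two] at hb
    exact ⟨b 0, left_ne_zero_of_mul hb, fun p hp => by simpa using hbK 0 p hp⟩

end Devices

theorem TheoryStrategy.not_wins_mainGame (S : TheoryStrategy.{u} mainGame) : ¬ S.Wins := by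
  classical
  intro h
  have hbeh : ∀ ω x a, S.behaviour ω x a =
      ENNReal.ofReal (S.devices.probability (fun _ => ω) x a) := fun ω x a => by
    unfold behaviour
    rw [Devices.circuit_single]
  obtain ⟨ω, hω⟩ := NonlocalGame.Won.exists_forall_rule (fun ω x => by
    rw [tsum_fintype]
    simp only [hbeh]
    rw [← ENNReal.ofReal_sum_of_nonneg fun a _ =>
      S.nonsignalling.probability_nonneg (fun _ => ω) x a]
    have := S.nonsignalling.sum_probability (fun _ => ω) x
    refine le_of_eq ((congrArg ENNReal.ofReal ?_).trans ENNReal.ofReal_one)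
    convert this) h
  refine (S.nonsignalling.bipartitePossibility fun _ => ω).mainGame_false fun x hx => ?_
  have hne : ∀ a, S.behaviour ω x a ≠ 0 ↔ S.devices.probability (fun _ => ω) x a ≠ 0 := by
    intro a
    rw [hbeh, Ne, ENNReal.ofReal_eq_zero, not_le]
    exact ⟨ne_of_gt, (S.nonsignalling.probability_nonneg _ x a).lt_of_ne'⟩
  simpa only [hne] using hω x hx

theorem theorem1 :
    (∀ S : BoxStrategy.{u, v} mainGame, ¬ S.Wins) ∧
    (∀ S : TheoryStrategy.{u} mainGame, ¬ S.Wins) :=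
  ⟨BoxStrategy.not_wins_mainGame, TheoryStrategy.not_wins_mainGame⟩
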